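/- Let $(\Omega,\mathcal F,\mathbb P)$ be a probability space, and write $L^0$, $L^1$, $L^\infty$ for the usual spaces of (classes of) real random variables on it. Let $l:\mathbb R\to\mathbb R$ be an increasing (i.e. non-decreasing) convex function with $l(0)>\inf_x l(x)$, and put $\Phi_l(x):=l(|x|)-l(0)$. Let $\mathcal P$ be a non-empty set of probability measures $P\ll\mathbb P$ which, identified with the set of densities $\{dP/d\mathbb P : P\in\mathcal P\}\subset L^1$, is convex and weakly compact in $L^1$. Define the robust shortfall risk function $$\varphi_{l,\mathcal P}(X):=\inf\Big\{x\in\mathbb R:\ \sup_{P\in\mathcal P}\mathbb E_P[l(X-x)]\le l(0)\Big\},\qquad X\in L^\infty,$$ its conjugate $\varphi_{l,\mathcal P}^*(Z):=\sup_{X\in L^\infty}\big(\mathbb E[XZ]-\varphi_{l,\mathcal P}(X)\big)$ for $Z\in L^1$, and $$\hat\varphi_{l,\mathcal P}(X):=\sup_{Z\in L^1,\ \varphi_{l,\mathcal P}^*(Z)<\infty}\big(\mathbb E[XZ]-\varphi_{l,\mathcal P}^*(Z)\big)\in(-\infty,\infty],\qquad X\in L^0,\ X\ge 0 .$$ Define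 the following subsets of $L^0$: $$M^{\hat\varphi_{l,\mathcal P}}:=\{X:\ \hat\varphi_{l,\mathcal P}(\alpha|X|)<\infty\ \ \forall\alpha>0\},\qquad M_u^{\hat\varphi_{l,\mathcal P}}:=\{X:\ \lim_{N\to\infty}\hat\varphi_{l,\mathcal P}(\alpha|X|\mathbf 1_{\{|X|>N\}})=0\ \ \forall\alpha>0\},$$ $$M^{\Phi_l}(\mathcal P):=\{X:\ \sup_{P\in\mathcal P}\mathbb E_P[\Phi_l(\lambda|X|)]<\infty\ \ \forall\lambda>0\},\qquad M_u^{\Phi_l}(\mathcal P):=\{X:\ \lim_{N\to\infty}\sup_{P\in\mathcal P}\mathbb E_P[\Phi_l(\lambda|X|)\mathbf 1_{\{|X|>N\}}]=0\ \ \forall\lambda>0\}.$$ Then $\varphi_{l,\mathcal P}$ is a convex risk function on $L^\infty$ (a proper convex function with values in $(-\infty,\infty]$ that is increasing in the a.s. order and satisfies $\varphi_{l,\mathcal P}(X+c)=\varphi_{l,\mathcal P}(X)+c$ for all $c\in\mathbb R$), it has the Lebesgue property on $L^\infty$, i.e. $\varphi_{l,\mathcal P}(X_n)\to\varphi_{l,\mathcal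 P}(X)$ whenever $\sup_n\|X_n\|_\infty<\infty$ and $X_n\to X$ a.s., and $$M_u^{\Phi_l}(\mathcal P)=M_u^{\hat\varphi_{l,\mathcal P}}\subset M^{\hat\varphi_{l,\mathcal P}}\subset M^{\Phi_l}(\mathcal P).$$ -/

import Mathlib

open MeasureTheory Filter Topology
open scoped ENNReal

namespace RobustShortfall

noncomputable section

/-- The set of Radon-Nikodym densities `dP/dℙ ∈ L¹(ℙ)` of the measures `P ∈ 𝒬`. -/
def densities {Ω : Type*} [MeasurableSpace Ω] (ℙ : Measure Ω) (𝒬 : Set (Measure Ω)) :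
    Set (Lp ℝ 1 ℙ) :=
  {Z | ∃ P ∈ 𝒬, ∀ᵐ ω ∂ℙ, Z ω = (P.rnDeriv ℙ ω).toReal}

/-- `𝒬` is convex and weakly compact in `L¹(ℙ)`, measures being identified with their densities. -/
def IsConvexWeaklyCompact {Ω : Type*} [MeasurableSpace Ω] (ℙ : Measure Ω)
    (𝒬 : Set (Measure Ω)) : Prop :=
  Convex ℝ (densities ℙ 𝒬) ∧
    IsCompact (toWeakSpace ℝ (Lp ℝ 1 ℙ) '' densities ℙ 𝒬)

/-- The robust shortfall risk function on `L^∞`: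
`φ_{l,𝒬}(X) = inf {x ∈ ℝ | sup_{P ∈ 𝒬} E_P[l(X - x)] ≤ l(0)}`, as an extended real. -/
def shortfall {Ω : Type*} [MeasurableSpace Ω] (ℙ : Measure Ω) (l : ℝ → ℝ)
    (𝒬 : Set (Measure Ω)) (X : Lp ℝ ∞ ℙ) : EReal :=
  sInf ((fun x : ℝ => (x : EReal)) ''
    {x : ℝ | (⨆ P ∈ 𝒬, ((∫ ω, l (X ω - x) ∂P : ℝ) : EReal)) ≤ (l 0 : EReal)})

/-- A convex risk function on `L^∞`: a proper convex function with values in `(-∞, ∞]`,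
increasing for the a.s. order and cash-invariant. -/
structure IsConvexRiskFunction {Ω : Type*} [MeasurableSpace Ω] (ℙ : Measure Ω)
    [IsFiniteMeasure ℙ] (φ : Lp ℝ ∞ ℙ → EReal) : Prop where
  ne_bot : ∀ X, φ X ≠ ⊥
  exists_ne_top : ∃ X, φ X ≠ ⊤
  monotone : ∀ X Y : Lp ℝ ∞ ℙ, X ≤ Y → φ X ≤ φ Y
  convex : ∀ X Y : Lp ℝ ∞ ℙ, ∀ t : ℝ, 0 ≤ t → t ≤ 1 →
    φ (t • X + (1 - t) • Y) ≤ (t : EReal) * φ X + ((1 - t : ℝ) : EReal) * φ Y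
  cash : ∀ (X : Lp ℝ ∞ ℙ) (c : ℝ), φ (X + Lp.const ∞ ℙ c) = φ X + (c : EReal)

/-- The Lebesgue property on `L^∞`: `φ(Xₙ) → φ(X)` whenever `sup ‖Xₙ‖_∞ < ∞` and
`Xₙ → X` almost surely. -/
def IsLebesgue {Ω : Type*} [MeasurableSpace Ω] (ℙ : Measure Ω)
    (φ : Lp ℝ ∞ ℙ → EReal) : Prop :=
  ∀ (u : ℕ → Lp ℝ ∞ ℙ) (X : Lp ℝ ∞ ℙ), (∃ C : ℝ, ∀ n, ‖u n‖ ≤ C) →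
    (∀ᵐ ω ∂ℙ, Tendsto (fun n => u n ω) atTop (𝓝 (X ω))) →
    Tendsto (fun n => φ (u n)) atTop (𝓝 (φ X))

/-- The conjugate `φ*(Z) = sup_{X ∈ L^∞} (E[XZ] - φ(X))` for `Z ∈ L¹`. -/
def conjugate {Ω : Type*} [MeasurableSpace Ω] (ℙ : Measure Ω)
    (φ : Lp ℝ ∞ ℙ → EReal) (Z : Lp ℝ 1 ℙ) : EReal :=
  ⨆ X : Lp ℝ ∞ ℙ, (((∫ ω, X ω * Z ω ∂ℙ : ℝ) : EReal) - φ X)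

/-- The extended-real expectation `E[f⁺] - E[f⁻]`, meaningful if one of the two is finite. -/
def expect {Ω : Type*} [MeasurableSpace Ω] (ℙ : Measure Ω) (f : Ω → ℝ) : EReal :=
  ((∫⁻ ω, ENNReal.ofReal (f ω) ∂ℙ : ℝ≥0∞) : EReal) -
    ((∫⁻ ω, ENNReal.ofReal (-f ω) ∂ℙ : ℝ≥0∞) : EReal)

/-- The extension `φ̂(X) = sup_{Z ∈ dom φ*} (E[XZ] - φ*(Z))`, for a random variable `X` with
`X⁻ Z ∈ L¹` for all `Z ∈ dom φ*`, in particular for every `X ≥ 0` when `φ` is monotone.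
It depends on `X` only up to a.s. equality. -/
def hatExt {Ω : Type*} [MeasurableSpace Ω] (ℙ : Measure Ω)
    (φ : Lp ℝ ∞ ℙ → EReal) (X : Ω → ℝ) : EReal :=
  ⨆ Z ∈ {Z : Lp ℝ 1 ℙ | conjugate ℙ φ Z < ⊤},
    (expect ℙ (fun ω => X ω * Z ω) - conjugate ℙ φ Z)

/-- `M^φ̂ = {X ∈ L⁰ | φ̂(α|X|) < ∞ for all α > 0}`. -/
def heart {Ω : Type*} [MeasurableSpace Ω] (ℙ : Measure Ω)
    (φ : Lp ℝ ∞ ℙ → EReal) : Set (Ω →ₘ[ℙ] ℝ) :=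
  {X | ∀ α : ℝ, 0 < α → hatExt ℙ φ (fun ω => α * |X ω|) < ⊤}

/-- `M^φ̂_u = {X ∈ L⁰ | lim_N φ̂(α|X| 1_{|X| > N}) = 0 for all α > 0}`. -/
def heartU {Ω : Type*} [MeasurableSpace Ω] (ℙ : Measure Ω)
    (φ : Lp ℝ ∞ ℙ → EReal) : Set (Ω →ₘ[ℙ] ℝ) :=
  {X | ∀ α : ℝ, 0 < α →
    Tendsto (fun N : ℕ => hatExt ℙ φ
      ({ω | (N : ℝ) < |X ω|}.indicator (fun ω => α * |X ω|))) atTop (𝓝 0)}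

/-- The Young function `Φ_l(x) = l(|x|) - l(0)`. -/
def young (l : ℝ → ℝ) (x : ℝ) : ℝ := l |x| - l 0

/-- `M^{Φ_l}(𝒬) = {X ∈ L⁰ | sup_{P ∈ 𝒬} E_P[Φ_l(λ|X|)] < ∞ for all λ > 0}`. -/
def robustHeart {Ω : Type*} [MeasurableSpace Ω] (ℙ : Measure Ω) (l : ℝ → ℝ)
    (𝒬 : Set (Measure Ω)) : Set (Ω →ₘ[ℙ] ℝ) :=
  {X | ∀ c : ℝ, 0 < c →
    (⨆ P ∈ 𝒬, ∫⁻ ω, ENNReal.ofReal (young l (c * |X ω|)) ∂P) < ∞}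

/-- `M^{Φ_l}_u(𝒬) = {X ∈ L⁰ | lim_N sup_{P ∈ 𝒬} E_P[Φ_l(λ|X|) 1_{|X| > N}] = 0
for all λ > 0}`. -/
def robustHeartU {Ω : Type*} [MeasurableSpace Ω] (ℙ : Measure Ω) (l : ℝ → ℝ)
    (𝒬 : Set (Measure Ω)) : Set (Ω →ₘ[ℙ] ℝ) :=
  {X | ∀ c : ℝ, 0 < c →
    Tendsto (fun N : ℕ => ⨆ P ∈ 𝒬,
      ∫⁻ ω in {ω | (N : ℝ) < |X ω|}, ENNReal.ofReal (young l (c * |X ω|)) ∂P) atTop (𝓝 0)}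

end

end RobustShortfall

namespace RobustShortfall

/-! For bounded `X`, the amounts `x` with `E_P[l(X - x)] ≤ l(0)` under all models form an up-closed
set that contains `‖X‖` and is bounded below by `E_P[X]`. So the risk `φ` is real-valued, and the
risk-function axioms come from monotonicity and convexity of `l`.

Lebesgue property: by Dini's theorem on the weakly compact set of densities, bounded functions
decreasing to zero have expectations tending to zero uniformly in `P`; tail suprema extend this to
bounded a.s. null sequences (`eventually_integral_abs_lt`). Convexity gives a slack, uniform in `P`,
at every amount above `φ(X)`, which absorbs the error.

The comparison of spaces needs no dual representation of `φ`, only two estimates for `φ̂`. Above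
(`hatExt_le`): if one capital `e` covers all truncations of `W`, Fenchel–Young and monotone
convergence give `φ̂(W) ≤ e`. Below (`le_hatExt`): if `E_P[l(Y - x)] = l(0)`, the density
proportional to `l'(Y - x)` under `P` is a subgradient, so `x ≤ φ̂(W)` for every `W ≥ Y ≥ 0`. With
midpoint convexity the lower estimate bounds the expected loss of `W` by `φ̂(2W)`
(`lintegral_le_of_hatExt_le`). Conversely, a small tail loss makes truncated tails acceptable at
small capital (`integral_min_tail_le`). -/

/-- A loss function: increasing, convex, and not minimal at `0`. -/
structure IsLoss (l : ℝ → ℝ) : Prop where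
  mono : Monotone l
  convex : ConvexOn ℝ Set.univ l
  exists_lt : ∃ x, l x < l 0

/-! ### Convex loss functions -/

namespace IsLoss

variable {l : ℝ → ℝ}

theorem continuous (hl : IsLoss l) : Continuous l :=
  continuousOn_univ.mp (hl.convex.continuousOn isOpen_univ)

/-- The right derivative of `l` is a subgradient. -/
theorem add_rightDeriv_mul_le (hl : IsLoss l) (a b : ℝ) :
    l a + derivWithin l (Set.Ioi a) a * (b - a) ≤ l b := by
  have hint : a ∈ interior (Set.univ : Set ℝ) := by simp
  rcases lt_trichotomy a b with h | rfl | h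
  · have h1 := hl.convex.rightDeriv_le_slope_of_mem_interior hint (Set.mem_univ b) h
    rw [slope_def_field, le_div_iff₀ (by linarith)] at h1
    linarith
  · simp
  · have h1 := hl.convex.slope_le_leftDeriv_of_mem_interior (Set.mem_univ b) hint h
    have h2 := hl.convex.leftDeriv_le_rightDeriv_of_mem_interior hint
    have h3 := h1.trans h2
    rw [slope_def_field, div_le_iff₀ (by linarith)] at h3
    linarith

theorem monotone_rightDeriv (hl : IsLoss l) :
    Monotone fun a => derivWithin l (Set.Ioi a) a := by
  have := hl.convex.monotoneOn_rightDeriv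
  rwa [interior_univ, monotoneOn_univ] at this

theorem rightDeriv_nonneg (hl : IsLoss l) (a : ℝ) : 0 ≤ derivWithin l (Set.Ioi a) a := by
  have h1 := hl.add_rightDeriv_mul_le a (a - 1)
  have h2 := hl.mono (show a - 1 ≤ a by linarith)
  linarith

theorem rightDeriv_zero_pos (hl : IsLoss l) : 0 < derivWithin l (Set.Ioi 0) 0 := by
  obtain ⟨x, hx⟩ := hl.exists_lt
  have h1 := hl.add_rightDeriv_mul_le 0 x
  refine lt_of_le_of_ne (hl.rightDeriv_nonneg 0) fun h => ?_
  rw [← h] at h1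
  linarith

/-- Otherwise the subgradient at `y` would be zero, making `l y ≥ l 0` the global minimum of `l`. -/
theorem lt_of_neg (hl : IsLoss l) {y : ℝ} (hy : y < 0) : l y < l 0 := by
  by_contra! h
  have h1 := hl.add_rightDeriv_mul_le y 0
  obtain ⟨x, hx⟩ := hl.exists_lt
  have h2 := hl.add_rightDeriv_mul_le y x
  have h3 := hl.rightDeriv_nonneg y
  have h4 : derivWithin l (Set.Ioi y) y = 0 := by nlinarith
  rw [h4] at h2
  linarith

theorem lt_of_pos (hl : IsLoss l) {y : ℝ} (hy : 0 < y) : l 0 < l y := by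
  have h1 := hl.add_rightDeriv_mul_le 0 y
  have := mul_pos hl.rightDeriv_zero_pos hy
  linarith

theorem le_midpoint (hl : IsLoss l) (a b : ℝ) : l ((a + b) / 2) ≤ (l a + l b) / 2 := by
  have := hl.convex.2 (Set.mem_univ a) (Set.mem_univ b) (show (0 : ℝ) ≤ 1 / 2 by norm_num)
    (show (0 : ℝ) ≤ 1 / 2 by norm_num) (by norm_num)
  simp only [smul_eq_mul] at this
  rw [show (a + b) / 2 = 1 / 2 * a + 1 / 2 * b by ring]
  linarith

end IsLoss

/-! ### Acceptable capital and the risk-function axioms -/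

/-- A non-empty set of probability measures absolutely continuous with respect to `ℙ`. -/
structure IsModelSet {Ω : Type*} [MeasurableSpace Ω] (ℙ : Measure Ω) (𝒬 : Set (Measure Ω)) :
    Prop where
  nonempty : 𝒬.Nonempty
  prob : ∀ P ∈ 𝒬, IsProbabilityMeasure P
  ac : ∀ P ∈ 𝒬, P ≪ ℙ

/-- The capital amounts `x` making the position `X - x` acceptable under every model. -/
def acceptable {Ω : Type*} [MeasurableSpace Ω] (l : ℝ → ℝ) (𝒬 : Set (Measure Ω))
    (X : Ω → ℝ) : Set ℝ :=
  {x | ∀ P ∈ 𝒬, ∫ ω, l (X ω - x) ∂P ≤ l 0}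

/-- The robust shortfall risk as a real number. -/
noncomputable def shortfallReal {Ω : Type*} [MeasurableSpace Ω] (l : ℝ → ℝ)
    (𝒬 : Set (Measure Ω)) (X : Ω → ℝ) : ℝ :=
  sInf (acceptable l 𝒬 X)

section

variable {Ω : Type*} [MeasurableSpace Ω] {ℙ P : Measure Ω} {l : ℝ → ℝ} {𝒬 : Set (Measure Ω)}

theorem ae_abs_le_norm (hP : P ≪ ℙ) (X : Lp ℝ ∞ ℙ) : ∀ᵐ ω ∂P, |X ω| ≤ ‖X‖ := by
  refine hP.ae_le ?_
  have h := ae_le_eLpNormEssSup (f := X) (μ := ℙ)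
  have hX := Lp.eLpNorm_ne_top X
  rw [eLpNorm_exponent_top] at hX
  filter_upwards [h] with ω hω
  rw [Lp.norm_def, eLpNorm_exponent_top, ← Real.norm_eq_abs, ← toReal_enorm]
  exact ENNReal.toReal_mono hX hω

theorem aemeasurable_coe (hP : P ≪ ℙ) (X : Lp ℝ ∞ ℙ) : AEMeasurable X P :=
  (Lp.aestronglyMeasurable X).aemeasurable.mono_ac hP

theorem integrable_monotone_comp [IsFiniteMeasure P] (hP : P ≪ ℙ) {h : ℝ → ℝ} (hh : Monotone h)
    (X : Lp ℝ ∞ ℙ) (x : ℝ) : Integrable (fun ω => h (X ω - x)) P := by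
  refine Integrable.of_mem_Icc (h (-‖X‖ - x)) (h (‖X‖ - x))
    (hh.measurable.comp_aemeasurable ((aemeasurable_coe hP X).sub_const x)) ?_
  filter_upwards [ae_abs_le_norm hP X] with ω hω
  rw [abs_le] at hω
  exact ⟨hh (by linarith), hh (by linarith)⟩

theorem integrable_coe [IsFiniteMeasure P] (hP : P ≪ ℙ) (X : Lp ℝ ∞ ℙ) : Integrable X P := by
  simpa using integrable_monotone_comp hP monotone_id X 0

/-- Only the difference `X - x` matters. Monotonicity, cash invariance and up-closedness of the
acceptable amounts are all instances. -/
theorem acceptable_of_le (hl : IsLoss l) (h𝒬 : IsModelSet ℙ 𝒬) {X Y : Lp ℝ ∞ ℙ} {x y : ℝ}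
    (h : ∀ᵐ ω ∂ℙ, X ω - x ≤ Y ω - y) (hy : y ∈ acceptable l 𝒬 Y) : x ∈ acceptable l 𝒬 X := by
  intro P hP
  have := h𝒬.prob P hP
  refine le_trans ?_ (hy P hP)
  refine integral_mono_ae (integrable_monotone_comp (h𝒬.ac P hP) hl.mono X x)
    (integrable_monotone_comp (h𝒬.ac P hP) hl.mono Y y) ?_
  filter_upwards [(h𝒬.ac P hP).ae_le h] with ω hω using hl.mono hω

theorem acceptable_of_ae_le (hl : IsLoss l) (h𝒬 : IsModelSet ℙ 𝒬) {X : Lp ℝ ∞ ℙ} {x : ℝ}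
    (h : ∀ᵐ ω ∂ℙ, X ω ≤ x) : x ∈ acceptable l 𝒬 X := by
  intro P hP
  have := h𝒬.prob P hP
  calc ∫ ω, l (X ω - x) ∂P ≤ ∫ _, l 0 ∂P := by
        refine integral_mono_ae (integrable_monotone_comp (h𝒬.ac P hP) hl.mono X x)
          (integrable_const _) ?_
        filter_upwards [(h𝒬.ac P hP).ae_le h] with ω hω using hl.mono (by linarith)
    _ = l 0 := by simp

theorem norm_mem_acceptable (hl : IsLoss l) (h𝒬 : IsModelSet ℙ 𝒬) (X : Lp ℝ ∞ ℙ) :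
    ‖X‖ ∈ acceptable l 𝒬 X := by
  refine acceptable_of_ae_le hl h𝒬 ?_
  filter_upwards [ae_abs_le_norm Measure.AbsolutelyContinuous.rfl X] with ω hω
    using (le_abs_self _).trans hω

/-- The expectation under any model is a lower bound of the acceptable amounts. -/
theorem integral_le_of_mem_acceptable (hl : IsLoss l) (h𝒬 : IsModelSet ℙ 𝒬) {X : Lp ℝ ∞ ℙ}
    {x : ℝ} (hx : x ∈ acceptable l 𝒬 X) (hP : P ∈ 𝒬) : ∫ ω, X ω ∂P ≤ x := by
  have := h𝒬.prob P hP
  have hi := integrable_coe (h𝒬.ac P hP) X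
  have hi' : Integrable (fun ω => X ω - x) P := hi.sub (integrable_const x)
  -- The supporting line of `l` at `0` has positive slope, so integrating it forces `E_P[X - x] ≤
  -- 0`.
  have h2 : ∫ ω, (l 0 + derivWithin l (Set.Ioi 0) 0 * (X ω - x)) ∂P ≤ l 0 := by
    refine le_trans (integral_mono_ae ?_ (integrable_monotone_comp (h𝒬.ac P hP) hl.mono X x) ?_)
      (hx P hP)
    · exact (integrable_const _).add (hi'.const_mul _)
    · exact ae_of_all _ fun ω => by simpa using hl.add_rightDeriv_mul_le 0 (X ω - x)
  rw [integral_add (integrable_const _) (hi'.const_mul _),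
    integral_const_mul, integral_sub hi (integrable_const _)] at h2
  simp only [integral_const, probReal_univ, smul_eq_mul, one_mul] at h2
  have := hl.rightDeriv_zero_pos
  by_contra! hc
  nlinarith [mul_pos this (sub_pos.mpr hc)]

theorem bddBelow_acceptable (hl : IsLoss l) (h𝒬 : IsModelSet ℙ 𝒬) (X : Lp ℝ ∞ ℙ) :
    BddBelow (acceptable l 𝒬 X) := by
  obtain ⟨P, hP⟩ := h𝒬.nonempty
  exact ⟨_, fun x hx => integral_le_of_mem_acceptable hl h𝒬 hx hP⟩

theorem shortfallReal_le (hl : IsLoss l) (h𝒬 : IsModelSet ℙ 𝒬) {X : Lp ℝ ∞ ℙ} {x : ℝ}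
    (hx : x ∈ acceptable l 𝒬 X) : shortfallReal l 𝒬 X ≤ x :=
  csInf_le (bddBelow_acceptable hl h𝒬 X) hx

theorem le_shortfallReal (hl : IsLoss l) (h𝒬 : IsModelSet ℙ 𝒬) {X : Lp ℝ ∞ ℙ} {c : ℝ}
    (hc : ∀ x ∈ acceptable l 𝒬 X, c ≤ x) : c ≤ shortfallReal l 𝒬 X :=
  le_csInf ⟨_, norm_mem_acceptable hl h𝒬 X⟩ hc

theorem mem_acceptable_of_lt (hl : IsLoss l) (h𝒬 : IsModelSet ℙ 𝒬) {X : Lp ℝ ∞ ℙ} {x : ℝ}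
    (hx : shortfallReal l 𝒬 X < x) : x ∈ acceptable l 𝒬 X := by
  obtain ⟨y, hy, hyx⟩ := exists_lt_of_csInf_lt ⟨_, norm_mem_acceptable hl h𝒬 X⟩ hx
  exact acceptable_of_le hl h𝒬 (ae_of_all _ fun ω => by linarith) hy

/-- The acceptable set is non-empty and bounded below, so the real `sInf` never takes its default
value. -/
theorem shortfall_eq_coe (hl : IsLoss l) (h𝒬 : IsModelSet ℙ 𝒬) (X : Lp ℝ ∞ ℙ) :
    shortfall ℙ l 𝒬 X = (shortfallReal l 𝒬 X : EReal) := by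
  have hset : {x : ℝ | (⨆ P ∈ 𝒬, ((∫ ω, l (X ω - x) ∂P : ℝ) : EReal)) ≤ (l 0 : EReal)} =
      acceptable l 𝒬 X := by
    ext x
    simp [acceptable]
  rw [shortfall, hset]
  apply le_antisymm
  · refine EReal.le_of_forall_lt_iff_le.mp fun z hz => ?_
    exact sInf_le ⟨z, mem_acceptable_of_lt hl h𝒬 (by exact_mod_cast hz), rfl⟩
  · refine le_sInf ?_
    rintro _ ⟨x, hx, rfl⟩
    exact EReal.coe_le_coe_iff.mpr (shortfallReal_le hl h𝒬 hx)

theorem shortfallReal_mono (hl : IsLoss l) (h𝒬 : IsModelSet ℙ 𝒬) {X Y : Lp ℝ ∞ ℙ}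
    (h : X ≤ Y) : shortfallReal l 𝒬 X ≤ shortfallReal l 𝒬 Y := by
  refine le_shortfallReal hl h𝒬 fun y hy => shortfallReal_le hl h𝒬 ?_
  refine acceptable_of_le hl h𝒬 ?_ hy
  filter_upwards [(Lp.coeFn_le X Y).mpr h] with ω hω using by linarith

theorem shortfallReal_convex (hl : IsLoss l) (h𝒬 : IsModelSet ℙ 𝒬) (X Y : Lp ℝ ∞ ℙ) {t : ℝ}
    (h0 : 0 ≤ t) (h1 : t ≤ 1) :
    shortfallReal l 𝒬 (t • X + (1 - t) • Y : Lp ℝ ∞ ℙ) ≤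
      t * shortfallReal l 𝒬 X + (1 - t) * shortfallReal l 𝒬 Y := by
  refine le_of_forall_pos_le_add fun ε hε => ?_
  have hx := mem_acceptable_of_lt hl h𝒬 (lt_add_of_pos_right (shortfallReal l 𝒬 X) hε)
  have hy := mem_acceptable_of_lt hl h𝒬 (lt_add_of_pos_right (shortfallReal l 𝒬 Y) hε)
  set x := shortfallReal l 𝒬 X + ε
  set y := shortfallReal l 𝒬 Y + ε
  have key : t * x + (1 - t) * y ∈ acceptable l 𝒬 (t • X + (1 - t) • Y : Lp ℝ ∞ ℙ) := by
    intro P hP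
    have := h𝒬.prob P hP
    have hac := h𝒬.ac P hP
    have iX := integrable_monotone_comp hac hl.mono X x
    have iY := integrable_monotone_comp hac hl.mono Y y
    calc ∫ ω, l ((t • X + (1 - t) • Y : Lp ℝ ∞ ℙ) ω - (t * x + (1 - t) * y)) ∂P
        ≤ ∫ ω, (t * l (X ω - x) + (1 - t) * l (Y ω - y)) ∂P := by
          refine integral_mono_ae (integrable_monotone_comp hac hl.mono _ _)
            ((iX.const_mul _).add (iY.const_mul _)) ?_
          filter_upwards [hac.ae_le (Lp.coeFn_add (t • X) ((1 - t) • Y)),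
            hac.ae_le (Lp.coeFn_smul t X), hac.ae_le (Lp.coeFn_smul (1 - t) Y)] with ω e1 e2 e3
          rw [e1, Pi.add_apply, e2, e3]
          have := hl.convex.2 (Set.mem_univ (X ω - x)) (Set.mem_univ (Y ω - y)) h0
            (sub_nonneg.mpr h1) (by ring)
          simp only [smul_eq_mul, Pi.smul_apply] at this ⊢
          convert this using 2
          ring
      _ = t * ∫ ω, l (X ω - x) ∂P + (1 - t) * ∫ ω, l (Y ω - y) ∂P := by
          rw [integral_add (iX.const_mul _) (iY.const_mul _), integral_const_mul,
            integral_const_mul]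
      _ ≤ t * l 0 + (1 - t) * l 0 :=
          add_le_add (mul_le_mul_of_nonneg_left (hx P hP) h0)
            (mul_le_mul_of_nonneg_left (hy P hP) (sub_nonneg.mpr h1))
      _ = l 0 := by ring
  have := shortfallReal_le hl h𝒬 key
  simp only [x, y] at this
  linarith

theorem shortfallReal_add_const [IsFiniteMeasure ℙ] (X : Lp ℝ ∞ ℙ) (c : ℝ)
    (hl : IsLoss l) (h𝒬 : IsModelSet ℙ 𝒬) :
    shortfallReal l 𝒬 (X + Lp.const ∞ ℙ c : Lp ℝ ∞ ℙ) = shortfallReal l 𝒬 X + c := by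
  have hae : ∀ᵐ ω ∂ℙ, (X + Lp.const ∞ ℙ c : Lp ℝ ∞ ℙ) ω = X ω + c := by
    filter_upwards [Lp.coeFn_add X (Lp.const ∞ ℙ c), Lp.coeFn_const ∞ ℙ c] with ω h1 h2
    rw [h1, Pi.add_apply, h2, Function.const_apply]
  apply le_antisymm
  · rw [← sub_le_iff_le_add]
    refine le_shortfallReal hl h𝒬 fun x hx => sub_le_iff_le_add.mpr <|
      shortfallReal_le hl h𝒬 (acceptable_of_le hl h𝒬 ?_ hx)
    filter_upwards [hae] with ω hω using by rw [hω]; linarith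
  · refine le_shortfallReal hl h𝒬 fun x hx => ?_
    rw [← le_sub_iff_add_le]
    refine shortfallReal_le hl h𝒬 (acceptable_of_le hl h𝒬 ?_ hx)
    filter_upwards [hae] with ω hω using by rw [hω]; linarith

theorem isConvexRiskFunction_shortfall [IsFiniteMeasure ℙ] (hl : IsLoss l)
    (h𝒬 : IsModelSet ℙ 𝒬) : IsConvexRiskFunction ℙ (shortfall ℙ l 𝒬) where
  ne_bot X := by rw [shortfall_eq_coe hl h𝒬]; exact EReal.coe_ne_bot _
  exists_ne_top := ⟨0, by rw [shortfall_eq_coe hl h𝒬]; exact EReal.coe_ne_top _⟩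
  monotone X Y h := by
    rw [shortfall_eq_coe hl h𝒬, shortfall_eq_coe hl h𝒬]
    exact_mod_cast shortfallReal_mono hl h𝒬 h
  convex X Y t h0 h1 := by
    rw [shortfall_eq_coe hl h𝒬, shortfall_eq_coe hl h𝒬, shortfall_eq_coe hl h𝒬]
    exact_mod_cast shortfallReal_convex hl h𝒬 X Y h0 h1
  cash X c := by
    rw [shortfall_eq_coe hl h𝒬, shortfall_eq_coe hl h𝒬]
    exact_mod_cast shortfallReal_add_const X c hl h𝒬
-- Uniform convergence over models and the Lebesgue property
/-- The density `dP/dℙ` as an element of `L¹(ℙ)`. -/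
noncomputable def density (ℙ P : Measure Ω) [IsFiniteMeasure P] : Lp ℝ 1 ℙ :=
  (Measure.integrable_toReal_rnDeriv (μ := P) (ν := ℙ)).toL1 _

theorem coeFn_density [IsFiniteMeasure P] :
    density ℙ P =ᵐ[ℙ] fun ω => (P.rnDeriv ℙ ω).toReal :=
  Integrable.coeFn_toL1 _

theorem integral_mul_density [SigmaFinite ℙ] [IsFiniteMeasure P] (hP : P ≪ ℙ) (f : Ω → ℝ) :
    ∫ ω, f ω * density ℙ P ω ∂ℙ = ∫ ω, f ω ∂P := by
  rw [← integral_rnDeriv_smul hP]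
  refine integral_congr_ae ?_
  filter_upwards [coeFn_density (ℙ := ℙ) (P := P)] with ω hω
  rw [hω, smul_eq_mul, mul_comm]

/-- Integration against a bounded function is weakly continuous on `L¹`. -/
theorem continuous_integral_mul (g : Lp ℝ ∞ ℙ) :
    Continuous fun Z : WeakSpace ℝ (Lp ℝ 1 ℙ) =>
      ∫ ω, g ω * ((toWeakSpace ℝ (Lp ℝ 1 ℙ)).symm Z) ω ∂ℙ := by
  have h := WeakBilin.eval_continuous (topDualPairing ℝ (Lp ℝ 1 ℙ)).flip
    ((ContinuousLinearMap.mul ℝ ℝ).lpPairing ℙ ∞ 1 g)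
  refine h.congr fun Z => ?_
  exact ((ContinuousLinearMap.mul ℝ ℝ).lpPairing_eq_integral (p := ∞) (q := 1) (μ := ℙ) g
    ((toWeakSpace ℝ (Lp ℝ 1 ℙ)).symm Z))

/-- Expectations of a sequence of bounded functions decreasing to zero tend to zero uniformly over
a weakly compact set of models. -/
theorem eventually_integral_le_of_antitone [IsProbabilityMeasure ℙ] (h𝒬 : IsModelSet ℙ 𝒬)
    (hc : IsCompact (toWeakSpace ℝ (Lp ℝ 1 ℙ) '' densities ℙ 𝒬))
    {g : ℕ → Ω → ℝ} {C : ℝ} (hg : ∀ n, AEMeasurable (g n) ℙ)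
    (h0 : ∀ n ω, 0 ≤ g n ω) (hC : ∀ n ω, g n ω ≤ C) (hanti : ∀ ω, Antitone fun n => g n ω)
    (hlim : ∀ᵐ ω ∂ℙ, Tendsto (fun n => g n ω) atTop (𝓝 0)) {ε : ℝ} (hε : 0 < ε) :
    ∀ᶠ n in atTop, ∀ P ∈ 𝒬, ∫ ω, g n ω ∂P < ε := by
  have hbd : ∀ n ω, ‖g n ω‖ ≤ C := fun n ω => by
    rw [Real.norm_of_nonneg (h0 n ω)]; exact hC n ω
  have hmem : ∀ n, MemLp (g n) ∞ ℙ := fun n =>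
    memLp_top_of_bound (hg n).aestronglyMeasurable C (ae_of_all _ (hbd n))
  have hrep : ∀ P ∈ 𝒬, ∀ Z : Lp ℝ 1 ℙ, (∀ᵐ ω ∂ℙ, Z ω = (P.rnDeriv ℙ ω).toReal) → ∀ n,
      ∫ ω, (hmem n).toLp (g n) ω * Z ω ∂ℙ = ∫ ω, g n ω ∂P := by
    intro P hP Z hZ n
    have := h𝒬.prob P hP
    rw [← integral_mul_density (h𝒬.ac P hP)]
    refine integral_congr_ae ?_
    filter_upwards [hZ, coeFn_density (ℙ := ℙ) (P := P), (hmem n).coeFn_toLp] with ω e1 e2 e3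
    rw [e1, e2, e3]
  have hint : ∀ P ∈ 𝒬, ∀ n, Integrable (g n) P := fun P hP n => by
    have := h𝒬.prob P hP
    exact Integrable.of_bound ((hg n).mono_ac (h𝒬.ac P hP)).aestronglyMeasurable C
      (ae_of_all _ (hbd n))
  -- Dini's theorem: the pairings are weakly continuous, decrease in `n`, and tend to zero at each
  -- density by dominated convergence.
  have hD := Antitone.tendstoUniformlyOn_of_forall_tendsto hc
    (F := fun n (Z : WeakSpace ℝ (Lp ℝ 1 ℙ)) =>
      ∫ ω, (hmem n).toLp (g n) ω * ((toWeakSpace ℝ (Lp ℝ 1 ℙ)).symm Z) ω ∂ℙ)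
    (f := fun _ => (0 : ℝ)) (fun n => (continuous_integral_mul _).continuousOn)
    (by
      rintro _ ⟨Z, ⟨P, hP, hZ⟩, rfl⟩ m n hmn
      simp only [LinearEquiv.symm_apply_apply]
      rw [hrep P hP Z hZ, hrep P hP Z hZ]
      exact integral_mono (hint P hP n) (hint P hP m) fun ω => hanti ω hmn)
    continuousOn_const
    (by
      rintro _ ⟨Z, ⟨P, hP, hZ⟩, rfl⟩
      simp only [LinearEquiv.symm_apply_apply]
      simp_rw [hrep P hP Z hZ]
      have := h𝒬.prob P hP
      have h := tendsto_integral_of_dominated_convergence (μ := P) (F := g) (f := fun _ => 0)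
        (fun _ => C) (fun n => ((hg n).mono_ac (h𝒬.ac P hP)).aestronglyMeasurable)
        (integrable_const _) (fun n => ae_of_all _ (hbd n)) ((h𝒬.ac P hP).ae_le hlim)
      simpa using h)
  filter_upwards [Metric.tendstoUniformlyOn_iff.mp hD ε hε] with n hn P hP
  have := h𝒬.prob P hP
  have h := hn (toWeakSpace ℝ (Lp ℝ 1 ℙ) (density ℙ P)) ⟨_, ⟨P, hP, coeFn_density⟩, rfl⟩
  simp only [LinearEquiv.symm_apply_apply] at h
  rw [hrep P hP _ coeFn_density, Real.dist_eq, zero_sub, abs_neg] at h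
  exact (le_abs_self _).trans_lt h

/-- Expectations of a uniformly bounded sequence tending to zero almost surely tend to zero
uniformly over a weakly compact set of models. -/
theorem eventually_integral_abs_lt [IsProbabilityMeasure ℙ] (h𝒬 : IsModelSet ℙ 𝒬)
    (hc : IsCompact (toWeakSpace ℝ (Lp ℝ 1 ℙ) '' densities ℙ 𝒬))
    {h : ℕ → Ω → ℝ} {C : ℝ} (hh : ∀ n, AEMeasurable (h n) ℙ)
    (hC : ∀ n, ∀ᵐ ω ∂ℙ, |h n ω| ≤ C)
    (hlim : ∀ᵐ ω ∂ℙ, Tendsto (fun n => h n ω) atTop (𝓝 0)) {ε : ℝ} (hε : 0 < ε) :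
    ∀ᶠ n in atTop, ∀ P ∈ 𝒬, ∫ ω, |h n ω| ∂P < ε := by
  set D := max C 0
  -- The bound `C` holds only almost surely; capping at `D` makes the suprema below bounded at every
  -- `ω`.
  set k : ℕ → Ω → ℝ := fun n ω => min D |h n ω|
  have hk0 : ∀ n ω, 0 ≤ k n ω := fun n ω => le_min (le_max_right _ _) (abs_nonneg _)
  have hkD : ∀ n ω, k n ω ≤ D := fun n ω => min_le_left _ _
  have hbdd : ∀ n ω, BddAbove (Set.range fun m => k (n + m) ω) := fun n ω =>
    ⟨D, by rintro _ ⟨m, rfl⟩; exact hkD _ _⟩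
  -- The tail suprema decrease to zero and dominate `|h n|` almost surely.
  have hev := eventually_integral_le_of_antitone h𝒬 hc (g := fun n ω => ⨆ m, k (n + m) ω)
    (C := D) (fun n => AEMeasurable.iSup fun m => aemeasurable_const.min (hh (n + m)).norm)
    (fun n ω => Real.iSup_nonneg fun m => hk0 _ _)
    (fun n ω => ciSup_le fun m => hkD _ _)
    (fun ω a b hab => ciSup_le fun m => by
      obtain ⟨c, rfl⟩ := Nat.exists_eq_add_of_le hab
      rw [add_assoc]
      exact le_ciSup (hbdd a ω) (c + m))
    (by
      filter_upwards [hlim] with ω hω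
      rw [Metric.tendsto_atTop] at hω ⊢
      intro δ hδ
      obtain ⟨N, hN⟩ := hω (δ / 2) (half_pos hδ)
      refine ⟨N, fun n hn => ?_⟩
      rw [Real.dist_eq, sub_zero, abs_of_nonneg (Real.iSup_nonneg fun m => hk0 _ _)]
      refine lt_of_le_of_lt (ciSup_le fun m => ?_) (half_lt_self hδ)
      have := hN (n + m) (by omega)
      rw [Real.dist_eq, sub_zero] at this
      exact (min_le_right _ _).trans this.le)
    hε
  filter_upwards [hev] with n hn P hP
  have := h𝒬.prob P hP
  have hac := h𝒬.ac P hP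
  refine lt_of_le_of_lt (integral_mono_ae ?_ ?_ ?_) (hn P hP)
  · refine Integrable.of_bound (C := C) ((hh n).norm.mono_ac hac).aestronglyMeasurable ?_
    filter_upwards [hac.ae_le (hC n)] with ω hω
    simpa using hω
  · refine Integrable.of_bound (C := D) ((AEMeasurable.iSup fun m =>
      aemeasurable_const.min (hh (n + m)).norm).mono_ac hac).aestronglyMeasurable
      (ae_of_all _ fun ω => ?_)
    rw [Real.norm_of_nonneg (Real.iSup_nonneg fun m => hk0 _ _)]
    exact ciSup_le fun m => hkD _ _
  · filter_upwards [hac.ae_le (hC n)] with ω hω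
    have h1 : k (n + 0) ω = |h n ω| := min_eq_right (hω.trans (le_max_left _ _))
    rw [← h1]
    exact le_ciSup (hbdd n ω) 0

theorem isLebesgue_shortfall [IsProbabilityMeasure ℙ] (hl : IsLoss l) (h𝒬 : IsModelSet ℙ 𝒬)
    (hc : IsCompact (toWeakSpace ℝ (Lp ℝ 1 ℙ) '' densities ℙ 𝒬)) :
    IsLebesgue ℙ (shortfall ℙ l 𝒬) := by
  rintro u X ⟨C, hC⟩ hu
  have hrefl : ℙ ≪ ℙ := Measure.AbsolutelyContinuous.rfl
  have key : ∀ x ε : ℝ, 0 < ε → ∀ᶠ n in atTop, ∀ P ∈ 𝒬,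
      |∫ ω, l (u n ω - x) ∂P - ∫ ω, l (X ω - x) ∂P| < ε := by
    intro x ε hε
    set B := max C ‖X‖
    have hev := eventually_integral_abs_lt h𝒬 hc (ε := ε)
      (h := fun n ω => l (u n ω - x) - l (X ω - x)) (C := l (B - x) - l (-B - x))
      (fun n => (integrable_monotone_comp hrefl hl.mono (u n) x).aemeasurable.sub
        (integrable_monotone_comp hrefl hl.mono X x).aemeasurable)
      (fun n => by
        filter_upwards [ae_abs_le_norm hrefl (u n), ae_abs_le_norm hrefl X] with ω h1 h2
        have h3 := abs_le.mp (h1.trans ((hC n).trans (le_max_left C ‖X‖)))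
        have h4 := abs_le.mp (h2.trans (le_max_right C ‖X‖))
        have a1 := hl.mono (show -B - x ≤ u n ω - x by linarith)
        have a2 := hl.mono (show u n ω - x ≤ B - x by linarith)
        have a3 := hl.mono (show -B - x ≤ X ω - x by linarith)
        have a4 := hl.mono (show X ω - x ≤ B - x by linarith)
        rw [abs_le]
        constructor <;> linarith)
      (by
        filter_upwards [hu] with ω hω
        have := (hl.continuous.tendsto (X ω - x)).comp (hω.sub_const x)
        simpa using this.sub_const (l (X ω - x)))
      hε
    filter_upwards [hev] with n hn P hP
    have := h𝒬.prob P hP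
    have hac := h𝒬.ac P hP
    rw [← integral_sub (integrable_monotone_comp hac hl.mono (u n) x)
      (integrable_monotone_comp hac hl.mono X x)]
    exact abs_integral_le_integral_abs.trans_lt (hn P hP)
  simp_rw [shortfall_eq_coe hl h𝒬]
  rw [EReal.tendsto_coe, tendsto_order]
  constructor
  · intro a ha
    obtain ⟨x, hax, hx⟩ := exists_between ha
    -- Lower bound: `x` fails strictly under a single model, and convergence under that model makes
    -- it fail for `u n` eventually.
    have hnot : x ∉ acceptable l 𝒬 X := fun h => (shortfallReal_le hl h𝒬 h).not_gt hx
    simp only [acceptable, Set.mem_ofPred_eq, not_forall, not_le] at hnot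
    obtain ⟨P, hP, hlt⟩ := hnot
    filter_upwards [key x _ (sub_pos.mpr hlt)] with n hn
    refine hax.trans_le ?_
    by_contra! hcon
    have h1 := mem_acceptable_of_lt hl h𝒬 hcon P hP
    have h2 := (abs_lt.mp (hn P hP)).1
    linarith
  · intro a ha
    obtain ⟨x, hx, hxa⟩ := exists_between ha
    obtain ⟨y, hy, hyx⟩ := exists_between hx
    have hy' := mem_acceptable_of_lt hl h𝒬 hy
    -- Upper bound: `x` lies between an acceptable `y` and an amount `M` with `X - M ≤ -1`. Writing
    -- `x = t y + (1 - t) M`, convexity gives `E_P[l(X - x)]` the slack `(1 - t)(l 0 - l (-1))` in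
    -- every model.
    set M := max x ‖X‖ + 1
    have hMx : x < M := by have := le_max_left x ‖X‖; simp only [M]; linarith
    have hMX : ‖X‖ ≤ M - 1 := by have := le_max_right x ‖X‖; simp only [M]; linarith
    have hpos : 0 < M - y := by linarith
    set t := (M - x) / (M - y)
    have ht0 : 0 ≤ t := div_nonneg (by linarith) hpos.le
    have ht1 : t < 1 := (div_lt_one hpos).mpr (by linarith)
    have htx : x = t * y + (1 - t) * M := by
      have : t * (M - y) = M - x := div_mul_cancel₀ _ hpos.ne'
      linarith
    have hδ : 0 < (1 - t) * (l 0 - l (-1)) :=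
      mul_pos (by linarith) (sub_pos.mpr (hl.lt_of_neg (by norm_num)))
    filter_upwards [key x _ hδ] with n hn
    refine lt_of_le_of_lt (shortfallReal_le hl h𝒬 fun P hP => ?_) hxa
    have := h𝒬.prob P hP
    have hac := h𝒬.ac P hP
    have iy := integrable_monotone_comp hac hl.mono X y
    have h1 : ∫ ω, l (X ω - x) ∂P ≤ t * l 0 + (1 - t) * l (-1) := by
      calc ∫ ω, l (X ω - x) ∂P ≤ ∫ ω, (t * l (X ω - y) + (1 - t) * l (-1)) ∂P := by
            refine integral_mono_ae (integrable_monotone_comp hac hl.mono X x)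
              ((iy.const_mul _).add (integrable_const _)) ?_
            filter_upwards [ae_abs_le_norm hac X] with ω hω
            have h2 := hl.convex.2 (Set.mem_univ (X ω - y)) (Set.mem_univ (-1 : ℝ)) ht0
              (sub_nonneg.mpr ht1.le) (by ring)
            refine le_trans (hl.mono ?_) h2
            simp only [smul_eq_mul]
            have h3 := (le_abs_self _).trans hω
            nlinarith
        _ = t * ∫ ω, l (X ω - y) ∂P + (1 - t) * l (-1) := by
            rw [integral_add (iy.const_mul _) (integrable_const _), integral_const_mul]
            simp
        _ ≤ _ := by
            have := mul_le_mul_of_nonneg_left (hy' P hP) ht0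
            linarith
    have h2 := (abs_lt.mp (hn P hP)).2
    linarith
-- The conjugate and upper bounds for `φ̂`
theorem conjugate_le_coe_iff (hl : IsLoss l) (h𝒬 : IsModelSet ℙ 𝒬) {Z : Lp ℝ 1 ℙ} {c : ℝ} :
    conjugate ℙ (shortfall ℙ l 𝒬) Z ≤ c ↔
      ∀ X : Lp ℝ ∞ ℙ, ∫ ω, X ω * Z ω ∂ℙ - shortfallReal l 𝒬 X ≤ c := by
  simp only [conjugate, iSup_le_iff, shortfall_eq_coe hl h𝒬]
  exact forall_congr' fun X => by rw [← EReal.coe_sub, EReal.coe_le_coe_iff]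

theorem conjugate_nonneg (hl : IsLoss l) (h𝒬 : IsModelSet ℙ 𝒬) (Z : Lp ℝ 1 ℙ) :
    0 ≤ conjugate ℙ (shortfall ℙ l 𝒬) Z := by
  refine le_trans ?_ (le_iSup _ (0 : Lp ℝ ∞ ℙ))
  have h0 : ∫ ω, (0 : Lp ℝ ∞ ℙ) ω * Z ω ∂ℙ = 0 := by
    refine integral_eq_zero_of_ae ?_
    filter_upwards [Lp.coeFn_zero ℝ ∞ ℙ] with ω hω
    rw [hω]; simp
  have h1 := shortfallReal_le hl h𝒬 (norm_mem_acceptable hl h𝒬 (0 : Lp ℝ ∞ ℙ))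
  rw [norm_zero] at h1
  rw [shortfall_eq_coe hl h𝒬, h0, ← EReal.coe_sub]
  exact EReal.coe_nonneg.mpr (by linarith)

theorem exists_conjugate_eq_coe (hl : IsLoss l) (h𝒬 : IsModelSet ℙ 𝒬) {Z : Lp ℝ 1 ℙ}
    (hZ : conjugate ℙ (shortfall ℙ l 𝒬) Z < ⊤) :
    ∃ c : ℝ, 0 ≤ c ∧ conjugate ℙ (shortfall ℙ l 𝒬) Z = c := by
  have h0 := conjugate_nonneg hl h𝒬 Z
  have hb : conjugate ℙ (shortfall ℙ l 𝒬) Z ≠ ⊥ := fun h => by simp [h] at h0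
  refine ⟨(conjugate ℙ (shortfall ℙ l 𝒬) Z).toReal, EReal.toReal_nonneg h0,
    (EReal.coe_toReal hZ.ne hb).symm⟩

/-- The test variables `-n 1_s` have risk at most zero, so `-n ∫_s Z` stays bounded in `n`. -/
theorem ae_nonneg_of_conjugate_lt_top [IsFiniteMeasure ℙ] (hl : IsLoss l)
    (h𝒬 : IsModelSet ℙ 𝒬) {Z : Lp ℝ 1 ℙ} (hZ : conjugate ℙ (shortfall ℙ l 𝒬) Z < ⊤) :
    ∀ᵐ ω ∂ℙ, 0 ≤ Z ω := by
  obtain ⟨c, -, hc⟩ := exists_conjugate_eq_coe hl h𝒬 hZ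
  have hX := (conjugate_le_coe_iff hl h𝒬).mp hc.le
  refine ae_nonneg_of_forall_setIntegral_nonneg (L1.integrable_coeFn Z) fun s hs hsℙ => ?_
  by_contra! hneg
  obtain ⟨n, hn⟩ := exists_nat_gt (c / -∫ ω in s, Z ω ∂ℙ)
  rw [div_lt_iff₀ (by linarith)] at hn
  have h1 := hX (indicatorConstLp ∞ hs hsℙ.ne (-(n : ℝ)))
  have h2 : ∫ ω, indicatorConstLp ∞ hs hsℙ.ne (-(n : ℝ)) ω * Z ω ∂ℙ =
      -(n : ℝ) * ∫ ω in s, Z ω ∂ℙ := by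
    rw [← integral_const_mul, ← integral_indicator hs]
    refine integral_congr_ae ?_
    filter_upwards [indicatorConstLp_coeFn (p := ∞) (hs := hs) (hμs := hsℙ.ne)
      (c := -(n : ℝ))] with ω hω
    rw [hω]
    by_cases h : ω ∈ s <;> simp [h]
  have h3 : shortfallReal l 𝒬 (indicatorConstLp ∞ hs hsℙ.ne (-(n : ℝ))) ≤ 0 := by
    refine shortfallReal_le hl h𝒬 (acceptable_of_ae_le hl h𝒬 ?_)
    filter_upwards [indicatorConstLp_coeFn (p := ∞) (hs := hs) (hμs := hsℙ.ne)
      (c := -(n : ℝ))] with ω hω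
    rw [hω]
    exact Set.indicator_nonpos (fun _ _ => by simp) ω
  rw [h2] at h1
  linarith

/-- A constant `r` has risk at most `r`, so `r (E[Z] - 1)` is bounded above over all real `r`, of
either sign. -/
theorem integral_eq_one_of_conjugate_lt_top [IsFiniteMeasure ℙ] (hl : IsLoss l)
    (h𝒬 : IsModelSet ℙ 𝒬) {Z : Lp ℝ 1 ℙ} (hZ : conjugate ℙ (shortfall ℙ l 𝒬) Z < ⊤) :
    ∫ ω, Z ω ∂ℙ = 1 := by
  obtain ⟨c, -, hc⟩ := exists_conjugate_eq_coe hl h𝒬 hZ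
  have hX := (conjugate_le_coe_iff hl h𝒬).mp hc.le
  have key : ∀ r : ℝ, r * (∫ ω, Z ω ∂ℙ - 1) ≤ c := by
    intro r
    have h1 := hX (Lp.const ∞ ℙ r)
    have h2 : ∫ ω, Lp.const ∞ ℙ r ω * Z ω ∂ℙ = r * ∫ ω, Z ω ∂ℙ := by
      rw [← integral_const_mul]
      refine integral_congr_ae ?_
      filter_upwards [Lp.coeFn_const ∞ ℙ r] with ω hω
      rw [hω, Function.const_apply]
    have h3 : shortfallReal l 𝒬 (Lp.const ∞ ℙ r) ≤ r := by
      refine shortfallReal_le hl h𝒬 (acceptable_of_ae_le hl h𝒬 ?_)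
      filter_upwards [Lp.coeFn_const ∞ ℙ r] with ω hω
      rw [hω, Function.const_apply]
    rw [h2] at h1
    linarith
  by_contra hne
  have h := key ((c + 1) / (∫ ω, Z ω ∂ℙ - 1))
  rw [div_mul_cancel₀ _ (sub_ne_zero.mpr hne)] at h
  linarith

theorem expect_of_nonneg {f : Ω → ℝ} (hf : ∀ᵐ ω ∂ℙ, 0 ≤ f ω) :
    expect ℙ f = ((∫⁻ ω, ENNReal.ofReal (f ω) ∂ℙ : ℝ≥0∞) : EReal) := by
  have : ∫⁻ ω, ENNReal.ofReal (-f ω) ∂ℙ = 0 := by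
    rw [lintegral_congr_ae (g := fun _ => 0), lintegral_zero]
    filter_upwards [hf] with ω hω using ENNReal.ofReal_of_nonpos (by linarith)
  rw [expect, this]
  simp

/-- Moves bounds on `φ̂` into `[0, ∞]`, where monotone convergence applies. Since `e` and `c` are
non-negative, `ENNReal.ofReal` does not clip `e + c`. -/
theorem hatExt_le_coe_iff [IsFiniteMeasure ℙ] (hl : IsLoss l) (h𝒬 : IsModelSet ℙ 𝒬)
    {W : Ω → ℝ} (hW : ∀ ω, 0 ≤ W ω) {e : ℝ} (he : 0 ≤ e) :
    hatExt ℙ (shortfall ℙ l 𝒬) W ≤ e ↔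
      ∀ (Z : Lp ℝ 1 ℙ) (c : ℝ), 0 ≤ c → conjugate ℙ (shortfall ℙ l 𝒬) Z = c →
        ∫⁻ ω, ENNReal.ofReal (W ω * Z ω) ∂ℙ ≤ ENNReal.ofReal (e + c) := by
  have key : ∀ (Z : Lp ℝ 1 ℙ) (c : ℝ), 0 ≤ c → conjugate ℙ (shortfall ℙ l 𝒬) Z = c →
      (expect ℙ (fun ω => W ω * Z ω) - conjugate ℙ (shortfall ℙ l 𝒬) Z ≤ e ↔
        ∫⁻ ω, ENNReal.ofReal (W ω * Z ω) ∂ℙ ≤ ENNReal.ofReal (e + c)) := by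
    intro Z c hc0 hc
    have hlt : conjugate ℙ (shortfall ℙ l 𝒬) Z < ⊤ := by rw [hc]; exact EReal.coe_lt_top c
    have hZ := ae_nonneg_of_conjugate_lt_top hl h𝒬 hlt
    rw [expect_of_nonneg (by filter_upwards [hZ] with ω hω using mul_nonneg (hW ω) hω), hc,
      EReal.sub_le_iff_le_add (Or.inl (EReal.coe_ne_bot _)) (Or.inl (EReal.coe_ne_top _)),
      ← EReal.coe_add, ← EReal.coe_ennreal_le_coe_ennreal_iff, EReal.coe_ennreal_ofReal,
      max_eq_left (by linarith)]
  constructor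
  · intro h Z c hc0 hc
    refine (key Z c hc0 hc).mp (le_trans ?_ h)
    exact le_iSup₂_of_le Z (by simp [hc]) le_rfl
  · intro h
    refine iSup₂_le fun Z hZ => ?_
    obtain ⟨c, hc0, hc⟩ := exists_conjugate_eq_coe hl h𝒬 hZ
    exact (key Z c hc0 hc).mpr (h Z c hc0 hc)

theorem memLp_top_min (hP : P ≪ ℙ) {W : Ω → ℝ} (hWm : AEMeasurable W ℙ) (hW : ∀ ω, 0 ≤ W ω)
    (n : ℕ) : MemLp (fun ω => min (W ω) n) ∞ P := by
  refine memLp_top_of_bound ((hWm.mono_ac hP).min aemeasurable_const).aestronglyMeasurable n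
    (ae_of_all _ fun ω => ?_)
  rw [Real.norm_of_nonneg (le_min (hW ω) n.cast_nonneg)]
  exact min_le_right _ _

theorem tendsto_min_natCast (x : ℝ) : Tendsto (fun n : ℕ => min x (n : ℝ)) atTop (𝓝 x) := by
  refine tendsto_const_nhds.congr' ?_
  filter_upwards [eventually_ge_atTop ⌈x⌉₊] with n hn
  exact (min_eq_left ((Nat.le_ceil x).trans (by exact_mod_cast hn))).symm

/-- If all truncations of `W ≥ 0` are acceptable with capital `e`, then `φ̂(W) ≤ e`. -/
theorem hatExt_le [IsFiniteMeasure ℙ] (hl : IsLoss l) (h𝒬 : IsModelSet ℙ 𝒬)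
    {W : Ω → ℝ} (hWm : AEMeasurable W ℙ) (hW : ∀ ω, 0 ≤ W ω) {e : ℝ} (he : 0 ≤ e)
    (h : ∀ n : ℕ, e ∈ acceptable l 𝒬 fun ω => min (W ω) n) :
    hatExt ℙ (shortfall ℙ l 𝒬) W ≤ e := by
  rw [hatExt_le_coe_iff hl h𝒬 hW he]
  intro Z c hc0 hc
  have hlt : conjugate ℙ (shortfall ℙ l 𝒬) Z < ⊤ := by rw [hc]; exact EReal.coe_lt_top c
  have hZ := ae_nonneg_of_conjugate_lt_top hl h𝒬 hlt
  have hZm : AEMeasurable Z ℙ := (Lp.aestronglyMeasurable Z).aemeasurable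
  have hmem := memLp_top_min Measure.AbsolutelyContinuous.rfl hWm hW
  refine le_of_tendsto' (lintegral_tendsto_of_tendsto_of_monotone (μ := ℙ)
    (f := fun (n : ℕ) ω => ENNReal.ofReal (min (W ω) n * Z ω))
    (fun n => ((hWm.min aemeasurable_const).mul hZm).ennreal_ofReal) ?_ ?_) fun n => ?_
  · filter_upwards [hZ] with ω hω m n hmn
    have : (m : ℝ) ≤ n := by exact_mod_cast hmn
    exact ENNReal.ofReal_le_ofReal (mul_le_mul_of_nonneg_right (min_le_min_left _ this) hω)
  · exact ae_of_all _ fun ω =>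
      ENNReal.tendsto_ofReal ((tendsto_min_natCast (W ω)).mul_const (Z ω))
  · have hacc : e ∈ acceptable l 𝒬 ((hmem n).toLp _) := by
      intro P hP
      refine le_trans (le_of_eq (integral_congr_ae ?_)) (h n P hP)
      filter_upwards [(h𝒬.ac P hP).ae_le (hmem n).coeFn_toLp] with ω hω
      rw [hω]
    -- Fenchel–Young for the truncation, whose risk is at most `e`.
    have h1 := (conjugate_le_coe_iff hl h𝒬).mp hc.le ((hmem n).toLp _)
    have h2 := shortfallReal_le hl h𝒬 hacc
    have h3 : ∫ ω, (hmem n).toLp _ ω * Z ω ∂ℙ = ∫ ω, min (W ω) n * Z ω ∂ℙ := by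
      refine integral_congr_ae ?_
      filter_upwards [(hmem n).coeFn_toLp] with ω hω
      rw [hω]
    have hi : Integrable (fun ω => min (W ω) n * Z ω) ℙ :=
      (L1.integrable_coeFn Z).bdd_mul (c := n) (hmem n).1 (ae_of_all _ fun ω => by
        rw [Real.norm_of_nonneg (le_min (hW ω) n.cast_nonneg)]
        exact min_le_right _ _)
    rw [← ofReal_integral_eq_lintegral_ofReal hi]
    · exact ENNReal.ofReal_le_ofReal (by linarith)
    · filter_upwards [hZ] with ω hω using mul_nonneg (le_min (hW ω) n.cast_nonneg) hω

/-! ### Subgradient densities and lower bounds for `φ̂` -/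

/-- The density of the measure with density `d` with respect to `P ≪ ℙ`. -/
theorem exists_density_mul [SigmaFinite ℙ] [SigmaFinite P] (hP : P ≪ ℙ) {d : Ω → ℝ}
    (hd : Integrable d P) (hd0 : ∀ ω, 0 ≤ d ω) :
    ∃ Z : Lp ℝ 1 ℙ, (∀ᵐ ω ∂ℙ, 0 ≤ Z ω) ∧
      ∀ f : Ω → ℝ, ∫ ω, f ω * Z ω ∂ℙ = ∫ ω, f ω * d ω ∂P := by
  have hi := (integrable_rnDeriv_smul_iff hP).mpr hd
  refine ⟨hi.toL1 _, ?_, fun f => ?_⟩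
  · filter_upwards [Integrable.coeFn_toL1 hi] with ω hω
    rw [hω]
    exact mul_nonneg ENNReal.toReal_nonneg (hd0 ω)
  · rw [← integral_rnDeriv_smul hP]
    refine integral_congr_ae ?_
    filter_upwards [Integrable.coeFn_toL1 hi] with ω hω
    rw [hω, smul_eq_mul, smul_eq_mul]
    ring

/-- The shortfall risk under a single model of a bounded `Y` is attained in the dual
representation, by the density `l'(Y - x) / E_P[l'(Y - x)]` with respect to `P`. -/
theorem exists_conjugate_le [SigmaFinite ℙ] (hl : IsLoss l) (h𝒬 : IsModelSet ℙ 𝒬) (hP : P ∈ 𝒬)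
    {Y : Lp ℝ ∞ ℙ} {x : ℝ} (hx : ∫ ω, l (Y ω - x) ∂P = l 0) :
    ∃ Z : Lp ℝ 1 ℙ, (∀ᵐ ω ∂ℙ, 0 ≤ Z ω) ∧
      conjugate ℙ (shortfall ℙ l 𝒬) Z ≤ (∫ ω, Y ω * Z ω ∂ℙ - x : ℝ) := by
  have := h𝒬.prob P hP
  have hac := h𝒬.ac P hP
  set D : Ω → ℝ := fun ω => derivWithin l (Set.Ioi (Y ω - x)) (Y ω - x) with hD
  have hDi : Integrable D P := integrable_monotone_comp hac hl.monotone_rightDeriv Y x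
  have hD0 : ∀ ω, 0 ≤ D ω := fun ω => hl.rightDeriv_nonneg _
  have hlY := integrable_monotone_comp hac hl.mono Y x
  -- If `D` vanished almost surely, then `Y - x < 0` and `l (Y - x) < l 0` almost surely,
  -- contradicting `hx`.
  have hc : 0 < ∫ ω, D ω ∂P := by
    refine lt_of_le_of_ne (integral_nonneg hD0) fun h => ?_
    have h1 := (integral_eq_zero_iff_of_nonneg hD0 hDi).mp h.symm
    have h2 : ∀ᵐ ω ∂P, l (Y ω - x) < l 0 := by
      filter_upwards [h1] with ω hω
      refine hl.lt_of_neg ?_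
      by_contra! hcon
      have h3 := hl.monotone_rightDeriv hcon
      have h4 : D ω = 0 := hω
      simp only [hD] at h4
      have := hl.rightDeriv_zero_pos
      simp only at h3
      linarith
    have hi : Integrable (fun ω => l 0 - l (Y ω - x)) P := (integrable_const _).sub hlY
    have h5 : 0 < ∫ ω, (l 0 - l (Y ω - x)) ∂P := by
      rw [integral_pos_iff_support_of_nonneg_ae (by
        filter_upwards [h2] with ω hω using (sub_pos.mpr hω).le) hi]
      have h6 : (Function.support fun ω => l 0 - l (Y ω - x)) =ᵐ[P] Set.univ := by
        rw [eventuallyEq_univ]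
        filter_upwards [h2] with ω hω using (sub_pos.mpr hω).ne'
      rw [measure_congr h6]
      simp
    have h6 := integral_sub (integrable_const (μ := P) (l 0)) hlY
    simp only [h6, hx, integral_const, probReal_univ, one_smul, sub_self, lt_irrefl] at h5
  set c := ∫ ω, D ω ∂P
  obtain ⟨Z, hZ0, hZ⟩ := exists_density_mul hac (hDi.div_const c)
    (fun ω => div_nonneg (hD0 ω) hc.le)
  refine ⟨Z, hZ0, (conjugate_le_coe_iff hl h𝒬).mpr fun V => ?_⟩
  rw [sub_le_comm]
  refine le_shortfallReal hl h𝒬 fun v hv => ?_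
  rw [hZ, hZ]
  have hmul : ∀ U : Lp ℝ ∞ ℙ, Integrable (fun ω => U ω * D ω) P := fun U =>
    hDi.bdd_mul (c := ‖U‖) (aemeasurable_coe hac U).aestronglyMeasurable
      (ae_abs_le_norm hac U)
  have hVY : Integrable (fun ω => V ω * D ω - Y ω * D ω) P := (hmul V).sub (hmul Y)
  have hsum : Integrable (fun ω => V ω * D ω - Y ω * D ω + (x - v) * D ω) P :=
    hVY.add (hDi.const_mul (x - v))
  -- The subgradient inequality at `Y - x`, evaluated at `V - v` and integrated. By `hx` it leaves
  -- `E_P[(V - Y + x - v) D] ≤ 0`, which is the claim after division by `c`.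
  have hsub : ∫ ω, (l (Y ω - x) + (V ω * D ω - Y ω * D ω + (x - v) * D ω)) ∂P ≤ l 0 := by
    refine le_trans (integral_mono_ae
      (hlY.add hsum)
      (integrable_monotone_comp hac hl.mono V v) (ae_of_all _ fun ω => ?_)) (hv P hP)
    have := hl.add_rightDeriv_mul_le (Y ω - x) (V ω - v)
    simp only [hD]
    linarith
  have e1 : ∫ ω, (l (Y ω - x) + (V ω * D ω - Y ω * D ω + (x - v) * D ω)) ∂P =
      l 0 + (∫ ω, V ω * D ω ∂P - ∫ ω, Y ω * D ω ∂P + (x - v) * c) := by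
    rw [integral_add hlY hsum, hx,
      integral_add hVY (hDi.const_mul (x - v)), integral_sub (hmul V) (hmul Y),
      integral_const_mul]
  rw [e1] at hsub
  simp_rw [← mul_div_assoc, integral_div]
  have e2 : (∫ ω, V ω * D ω ∂P) / c - ((∫ ω, Y ω * D ω ∂P) / c - x) =
      (∫ ω, V ω * D ω ∂P - ∫ ω, Y ω * D ω ∂P + x * c) / c := by
    field_simp
    ring
  rw [e2, div_le_iff₀ hc]
  linarith

/-- A lower bound of `φ̂` by the shortfall risk of a smaller bounded variable under one model. -/
theorem le_hatExt [IsFiniteMeasure ℙ] (hl : IsLoss l) (h𝒬 : IsModelSet ℙ 𝒬) (hP : P ∈ 𝒬)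
    {Y : Lp ℝ ∞ ℙ} {x : ℝ} (hx : ∫ ω, l (Y ω - x) ∂P = l 0) (hY : ∀ᵐ ω ∂ℙ, 0 ≤ Y ω)
    {W : Ω → ℝ} (hYW : ∀ᵐ ω ∂ℙ, Y ω ≤ W ω) :
    (x : EReal) ≤ hatExt ℙ (shortfall ℙ l 𝒬) W := by
  obtain ⟨Z, hZ0, hZ⟩ := exists_conjugate_le hl h𝒬 hP hx
  have hlt : conjugate ℙ (shortfall ℙ l 𝒬) Z < ⊤ := hZ.trans_lt (EReal.coe_lt_top _)
  refine le_iSup₂_of_le Z hlt ?_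
  have hi : Integrable (fun ω => Y ω * Z ω) ℙ :=
    (L1.integrable_coeFn Z).bdd_mul (c := ‖Y‖) (Lp.aestronglyMeasurable Y)
      (ae_abs_le_norm Measure.AbsolutelyContinuous.rfl Y)
  have hYZ : 0 ≤ᵐ[ℙ] fun ω => Y ω * Z ω := by
    filter_upwards [hY, hZ0] with ω h1 h2 using mul_nonneg h1 h2
  have h1 : ((∫ ω, Y ω * Z ω ∂ℙ : ℝ) : EReal) ≤ expect ℙ fun ω => W ω * Z ω := by
    rw [expect_of_nonneg (by
      filter_upwards [hY, hYW, hZ0] with ω a b c using mul_nonneg (a.trans b) c)]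
    have h2 : ENNReal.ofReal (∫ ω, Y ω * Z ω ∂ℙ) ≤ ∫⁻ ω, ENNReal.ofReal (W ω * Z ω) ∂ℙ := by
      rw [ofReal_integral_eq_lintegral_ofReal hi hYZ]
      refine lintegral_mono_ae ?_
      filter_upwards [hYW, hZ0] with ω a b
      exact ENNReal.ofReal_le_ofReal (mul_le_mul_of_nonneg_right a b)
    rw [← EReal.coe_ennreal_le_coe_ennreal_iff, EReal.coe_ennreal_ofReal,
      max_eq_left (integral_nonneg_of_ae hYZ)] at h2
    exact h2
  refine le_trans (le_of_eq ?_) (EReal.sub_le_sub h1 hZ)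
  rw [← EReal.coe_sub]
  congr 1
  ring

/-- Intermediate value theorem on `[-‖Y‖, ‖Y‖]`: `Y - x` is non-negative at the left end and
non-positive at the right. -/
theorem exists_integral_eq (hl : IsLoss l) (h𝒬 : IsModelSet ℙ 𝒬) (hP : P ∈ 𝒬)
    (Y : Lp ℝ ∞ ℙ) : ∃ x : ℝ, ∫ ω, l (Y ω - x) ∂P = l 0 := by
  have := h𝒬.prob P hP
  have hac := h𝒬.ac P hP
  have hcont : ContinuousOn (fun x => ∫ ω, l (Y ω - x) ∂P) (Set.Icc (-‖Y‖) ‖Y‖) := by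
    refine continuousOn_of_dominated
      (bound := fun _ => max |l (-‖Y‖ - ‖Y‖)| |l (‖Y‖ + ‖Y‖)|)
      (fun x _ => (integrable_monotone_comp hac hl.mono Y x).1) (fun x hx => ?_)
      (integrable_const _)
      (ae_of_all _ fun ω => (hl.continuous.comp (continuous_const.sub continuous_id)).continuousOn)
    filter_upwards [ae_abs_le_norm hac Y] with ω hω
    rw [abs_le] at hω
    exact abs_le_max_abs_abs (hl.mono (by linarith [hx.2])) (hl.mono (by linarith [hx.1]))
  have hn := norm_nonneg Y
  obtain ⟨x, -, hx⟩ := intermediate_value_Icc' (by linarith) hcont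
    (show l 0 ∈ _ from ⟨norm_mem_acceptable hl h𝒬 Y P hP, by
      calc l 0 = ∫ _, l 0 ∂P := by simp
        _ ≤ ∫ ω, l (Y ω - -‖Y‖) ∂P := by
          refine integral_mono_ae (integrable_const _)
            (integrable_monotone_comp hac hl.mono Y _) ?_
          filter_upwards [ae_abs_le_norm hac Y] with ω hω
          rw [abs_le] at hω
          exact hl.mono (by linarith)⟩)
  exact ⟨x, hx⟩

theorem hatExt_nonneg [IsFiniteMeasure ℙ] (hl : IsLoss l) (h𝒬 : IsModelSet ℙ 𝒬) {W : Ω → ℝ}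
    (hW : ∀ ω, 0 ≤ W ω) : 0 ≤ hatExt ℙ (shortfall ℙ l 𝒬) W := by
  obtain ⟨P, hP⟩ := h𝒬.nonempty
  have := h𝒬.prob P hP
  have h0 := Lp.coeFn_zero ℝ ∞ ℙ
  have := le_hatExt hl h𝒬 hP (Y := 0) (x := 0) (W := W) (by
    rw [integral_congr_ae (g := fun _ => l 0)]
    · simp
    · filter_upwards [(h𝒬.ac P hP).ae_le h0] with ω hω
      rw [hω]; simp)
    (by filter_upwards [h0] with ω hω; rw [hω]; rfl)
    (by filter_upwards [h0] with ω hω; rw [hω]; exact hW ω)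
  simpa using this

/-- Control of the expected loss under every model by `φ̂`. -/
theorem lintegral_le_of_hatExt_le [IsFiniteMeasure ℙ] (hl : IsLoss l) (h𝒬 : IsModelSet ℙ 𝒬)
    (hP : P ∈ 𝒬) {W : Ω → ℝ} (hWm : AEMeasurable W ℙ) (hW : ∀ ω, 0 ≤ W ω) {e : ℝ}
    (he : hatExt ℙ (shortfall ℙ l 𝒬) (fun ω => 2 * W ω) ≤ e) :
    ∫⁻ ω, ENNReal.ofReal (l (W ω) - l 0) ∂P ≤ ENNReal.ofReal ((l e - l 0) / 2) := by
  have := h𝒬.prob P hP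
  have hac := h𝒬.ac P hP
  have hW2 : ∀ ω, 0 ≤ 2 * W ω := fun ω => mul_nonneg zero_le_two (hW ω)
  have hmem := memLp_top_min (Measure.AbsolutelyContinuous.rfl (μ := ℙ)) (hWm.const_mul 2) hW2
  refine le_of_tendsto' (lintegral_tendsto_of_tendsto_of_monotone (μ := P)
    (f := fun (n : ℕ) ω => ENNReal.ofReal (l (min (2 * W ω) n / 2) - l 0))
    (fun n => ((hl.mono.measurable.comp_aemeasurable
      ((((hWm.mono_ac hac).const_mul 2).min aemeasurable_const).div_const 2)).sub_const
        _).ennreal_ofReal) ?_ ?_) fun n => ?_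
  · refine ae_of_all _ fun ω m n hmn => ENNReal.ofReal_le_ofReal (sub_le_sub_right (hl.mono ?_) _)
    have : (m : ℝ) ≤ n := by exact_mod_cast hmn
    linarith [min_le_min_left (2 * W ω) this]
  · refine ae_of_all _ fun ω => ENNReal.tendsto_ofReal (Tendsto.sub_const ?_ _)
    have h1 := (tendsto_min_natCast (2 * W ω)).div_const 2
    rw [mul_div_cancel_left₀ _ two_ne_zero] at h1
    exact (hl.continuous.tendsto _).comp h1
  · set Y := (hmem n).toLp _ with hYdef
    have hYae : ∀ᵐ ω ∂ℙ, Y ω = min (2 * W ω) n := (hmem n).coeFn_toLp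
    obtain ⟨x, hx⟩ := exists_integral_eq hl h𝒬 hP Y
    have hxe : x ≤ e := by
      have := (le_hatExt hl h𝒬 hP hx (W := fun ω => 2 * W ω)
        (by filter_upwards [hYae] with ω hω; rw [hω]; exact le_min (hW2 ω) n.cast_nonneg)
        (by filter_upwards [hYae] with ω hω; rw [hω]; exact min_le_left _ _)).trans he
      exact_mod_cast this
    have hlY := integrable_monotone_comp hac hl.mono Y x
    have hhalf : Integrable (fun ω => l (min (2 * W ω) n / 2) - l 0) P := by
      have h := (integrable_monotone_comp hac (h := fun y => l (y / 2))
        (fun a b hab => hl.mono (by linarith)) Y 0).sub (integrable_const (l 0))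
      refine h.congr ?_
      filter_upwards [hac.ae_le hYae] with ω hω
      simp [hω]
    rw [← ofReal_integral_eq_lintegral_ofReal hhalf (ae_of_all _ fun ω => sub_nonneg.mpr
      (hl.mono (div_nonneg (le_min (hW2 ω) n.cast_nonneg) zero_le_two)))]
    refine ENNReal.ofReal_le_ofReal ?_
    calc ∫ ω, (l (min (2 * W ω) n / 2) - l 0) ∂P
        ≤ ∫ ω, (l (Y ω - x) / 2 + (l e / 2 - l 0)) ∂P := by
          refine integral_mono_ae hhalf ((hlY.div_const 2).add (integrable_const _)) ?_
          filter_upwards [hac.ae_le hYae] with ω hω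
          -- Since `Y / 2` is the midpoint of `Y - x` and `x`, the loss splits into one with
          -- expectation `l 0` and one at most `l e`. This is why `φ̂` is taken at `2W`.
          have h1 := hl.le_midpoint (Y ω - x) x
          have h2 := hl.mono hxe
          rw [sub_add_cancel, hω] at h1
          rw [hω]
          linarith
      _ = (l e - l 0) / 2 := by
          rw [integral_add (hlY.div_const 2) (integrable_const _), integral_div, hx]
          simp
          ring
-- Comparison of the spaces
theorem measurableSet_tail (X : Ω →ₘ[ℙ] ℝ) (N : ℕ) : MeasurableSet {ω | (N : ℝ) < |X ω|} :=
  measurableSet_lt measurable_const X.measurable.abs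

theorem aemeasurable_tail (X : Ω →ₘ[ℙ] ℝ) (N : ℕ) (c : ℝ) :
    AEMeasurable ({ω | (N : ℝ) < |X ω|}.indicator fun ω => c * |X ω|) ℙ :=
  ((X.measurable.abs.const_mul c).indicator (measurableSet_tail X N)).aemeasurable

theorem tail_nonneg (X : Ω →ₘ[ℙ] ℝ) (N : ℕ) {c : ℝ} (hc : 0 ≤ c) (ω : Ω) :
    0 ≤ {ω | (N : ℝ) < |X ω|}.indicator (fun ω => c * |X ω|) ω :=
  Set.indicator_nonneg (fun _ _ => mul_nonneg hc (abs_nonneg _)) ω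

theorem young_mul_abs (l : ℝ → ℝ) {c : ℝ} (hc : 0 ≤ c) (x : ℝ) :
    young l (c * |x|) = l (c * |x|) - l 0 := by
  rw [young, abs_of_nonneg (mul_nonneg hc (abs_nonneg _))]

theorem heart_subset_robustHeart [IsFiniteMeasure ℙ] (hl : IsLoss l) (h𝒬 : IsModelSet ℙ 𝒬) :
    heart ℙ (shortfall ℙ l 𝒬) ⊆ robustHeart ℙ l 𝒬 := by
  intro X hX c hc
  obtain ⟨e, he, -⟩ := EReal.lt_iff_exists_real_btwn.mp (hX (2 * c) (by positivity))
  refine lt_of_le_of_lt (iSup₂_le fun P hP => ?_)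
    (ENNReal.ofReal_lt_top (r := (l e - l 0) / 2))
  simp_rw [young_mul_abs l hc.le]
  refine lintegral_le_of_hatExt_le hl h𝒬 hP (X.measurable.abs.const_mul c).aemeasurable
    (fun ω => mul_nonneg hc.le (abs_nonneg _)) ?_
  simp_rw [← mul_assoc]
  exact he.le

theorem heartU_subset_robustHeartU [IsFiniteMeasure ℙ] (hl : IsLoss l) (h𝒬 : IsModelSet ℙ 𝒬) :
    heartU ℙ (shortfall ℙ l 𝒬) ⊆ robustHeartU ℙ l 𝒬 := by
  intro X hX c hc
  rw [ENNReal.tendsto_nhds_zero]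
  intro ε hε
  have hlim : Tendsto (fun δ => ENNReal.ofReal ((l δ - l 0) / 2)) (𝓝[>] 0) (𝓝 0) := by
    have h := ENNReal.tendsto_ofReal (((hl.continuous.tendsto 0).sub_const (l 0)).div_const 2)
    simp only [sub_self, zero_div, ENNReal.ofReal_zero] at h
    exact h.mono_left nhdsWithin_le_nhds
  obtain ⟨δ, hδε, hδ⟩ := ((hlim.eventually_le_const hε).and self_mem_nhdsWithin).exists
  have hδ0 : (0 : ℝ) < δ := hδ
  filter_upwards [(hX (2 * c) (by positivity)).eventually_lt_const
    (show (0 : EReal) < (δ : EReal) by exact_mod_cast hδ0)] with N hN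
  refine iSup₂_le fun P hP => le_trans (le_of_eq ?_) ((lintegral_le_of_hatExt_le hl h𝒬 hP
    (aemeasurable_tail X N c) (tail_nonneg X N hc.le) (e := δ) ?_).trans hδε)
  · rw [← lintegral_indicator (measurableSet_tail X N)]
    refine lintegral_congr fun ω => ?_
    by_cases h : ω ∈ {ω | (N : ℝ) < |X ω|}
    · rw [Set.indicator_of_mem h, Set.indicator_of_mem h, young_mul_abs l hc.le]
    · rw [Set.indicator_of_notMem h, Set.indicator_of_notMem h]
      simp
  · refine le_trans (le_of_eq ?_) hN.le
    congr 1
    ext ω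
    by_cases h : ω ∈ {ω | (N : ℝ) < |X ω|}
    · rw [Set.indicator_of_mem h, Set.indicator_of_mem h, mul_assoc]
    · rw [Set.indicator_of_notMem h, Set.indicator_of_notMem h, mul_zero]

/-- `α|X|` is at most `αN` plus its tail beyond `N`. The constant costs exactly `αN` because each
`Z` in the domain integrates to one, and `N` is chosen so that the tail costs at most `1`. -/
theorem heartU_subset_heart [IsFiniteMeasure ℙ] (hl : IsLoss l) (h𝒬 : IsModelSet ℙ 𝒬) :
    heartU ℙ (shortfall ℙ l 𝒬) ⊆ heart ℙ (shortfall ℙ l 𝒬) := by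
  intro X hX α hα
  obtain ⟨N, hN⟩ := ((hX α hα).eventually_lt_const
    (show (0 : EReal) < ((1 : ℝ) : EReal) by exact_mod_cast one_pos)).exists
  have hN' := (hatExt_le_coe_iff hl h𝒬 (tail_nonneg X N hα.le) zero_le_one).mp hN.le
  have hb : 0 ≤ α * N := by positivity
  refine lt_of_le_of_lt ((hatExt_le_coe_iff hl h𝒬 (e := α * N + 1)
    (fun ω => mul_nonneg hα.le (abs_nonneg _)) (by linarith)).mpr fun Z c hc0 hc => ?_)
    (EReal.coe_lt_top _)
  have hlt : conjugate ℙ (shortfall ℙ l 𝒬) Z < ⊤ := by rw [hc]; exact EReal.coe_lt_top c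
  have hZ := ae_nonneg_of_conjugate_lt_top hl h𝒬 hlt
  have hZm : AEMeasurable Z ℙ := (Lp.aestronglyMeasurable Z).aemeasurable
  calc ∫⁻ ω, ENNReal.ofReal (α * |X ω| * Z ω) ∂ℙ
      ≤ ∫⁻ ω, (ENNReal.ofReal (α * N * Z ω) + ENNReal.ofReal
          ({ω | (N : ℝ) < |X ω|}.indicator (fun ω => α * |X ω|) ω * Z ω)) ∂ℙ := by
        refine lintegral_mono_ae ?_
        filter_upwards [hZ] with ω hω
        rw [← ENNReal.ofReal_add (mul_nonneg hb hω)
          (mul_nonneg (tail_nonneg X N hα.le ω) hω), ← add_mul]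
        refine ENNReal.ofReal_le_ofReal (mul_le_mul_of_nonneg_right ?_ hω)
        by_cases h : ω ∈ {ω | (N : ℝ) < |X ω|}
        · rw [Set.indicator_of_mem h]
          linarith
        · rw [Set.indicator_of_notMem h, add_zero]
          exact mul_le_mul_of_nonneg_left (not_lt.mp h) hα.le
    _ = ENNReal.ofReal (α * N) + ∫⁻ ω, ENNReal.ofReal
          ({ω | (N : ℝ) < |X ω|}.indicator (fun ω => α * |X ω|) ω * Z ω) ∂ℙ := by
        rw [lintegral_add_left' (hZm.const_mul _).ennreal_ofReal,
          ← ofReal_integral_eq_lintegral_ofReal ((L1.integrable_coeFn Z).const_mul _)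
            (by filter_upwards [hZ] with ω hω using mul_nonneg hb hω),
          integral_const_mul, integral_eq_one_of_conjugate_lt_top hl h𝒬 hlt, mul_one]
    _ ≤ ENNReal.ofReal (α * N) + ENNReal.ofReal (1 + c) := by
        gcongr
        exact hN' Z c hc0 hc
    _ = ENNReal.ofReal (α * N + 1 + c) := by
        rw [← ENNReal.ofReal_add hb (by linarith), add_assoc]

/-- If the tail loss of `α|X|` is small under a model, all truncations of the tail are acceptable
with a small capital. -/
theorem integral_min_tail_le (hl : IsLoss l) [IsProbabilityMeasure P] {X : Ω → ℝ}
    (hX : Measurable X) {α δ s : ℝ} (hα : 0 < α) {N : ℕ} (hN : 1 ≤ N)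
    (hs0 : 0 ≤ s) (hs1 : s ≤ (l 0 - l (-δ)) / 2) (hs2 : s ≤ (l α - l 0) / 2) (hδ : 0 < δ)
    (hs : ∫⁻ ω in {ω | (N : ℝ) < |X ω|}, ENNReal.ofReal (young l (α * |X ω|)) ∂P ≤
      ENNReal.ofReal s) (n : ℕ) :
    ∫ ω, l (min ({ω | (N : ℝ) < |X ω|}.indicator (fun ω => α * |X ω|) ω) n - δ) ∂P ≤ l 0 := by
  set A : Set Ω := {ω | (N : ℝ) < |X ω|}
  have hA : MeasurableSet A := measurableSet_lt measurable_const hX.abs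
  have hy : ∀ ω, young l (α * |X ω|) = l (α * |X ω|) - l 0 := fun ω => young_mul_abs l hα.le (X ω)
  have hy0 : ∀ ω, 0 ≤ young l (α * |X ω|) := fun ω => by
    rw [hy]; exact sub_nonneg.mpr (hl.mono (mul_nonneg hα.le (abs_nonneg _)))
  have hym : Measurable fun ω => young l (α * |X ω|) := by
    simp_rw [hy]
    exact (hl.mono.measurable.comp (hX.abs.const_mul α)).sub_const _
  have hyi : IntegrableOn (fun ω => young l (α * |X ω|)) A P := by
    refine ⟨hym.aestronglyMeasurable, ?_⟩
    rw [hasFiniteIntegral_iff_ofReal (ae_of_all _ hy0)]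
    exact hs.trans_lt ENNReal.ofReal_lt_top
  have hI : ∫ ω in A, young l (α * |X ω|) ∂P ≤ s := by
    rw [← ofReal_integral_eq_lintegral_ofReal hyi (ae_of_all _ hy0)] at hs
    exact (ENNReal.ofReal_le_ofReal_iff hs0).mp hs
  have hβ : 0 < l α - l 0 := sub_pos.mpr (hl.lt_of_pos hα)
  have hη : 0 < l 0 - l (-δ) := sub_pos.mpr (hl.lt_of_neg (by linarith))
  -- Markov's inequality: on `A`, `|X| > N ≥ 1`, so the Young function there is at least `l α - l 0
  -- ≥ 2s`.
  have hPA : P.real A ≤ 1 / 2 := by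
    have h1 : ∫ ω in A, (l α - l 0) ∂P ≤ ∫ ω in A, young l (α * |X ω|) ∂P := by
      refine setIntegral_mono_on (integrable_const _) hyi hA fun ω hω => ?_
      rw [hy]
      refine sub_le_sub_right (hl.mono ?_) _
      have h2 : (1 : ℝ) ≤ N := by exact_mod_cast hN
      have h3 : (N : ℝ) < |X ω| := hω
      nlinarith
    rw [setIntegral_const, smul_eq_mul] at h1
    by_contra! hcon
    nlinarith
  have hind : Integrable (A.indicator fun ω => (l 0 - l (-δ)) + young l (α * |X ω|)) P :=
    (integrable_indicator_iff hA).mpr ((integrable_const _).add hyi)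
  have hT0 : ∀ ω, 0 ≤ A.indicator (fun ω => α * |X ω|) ω := fun ω =>
    Set.indicator_nonneg (fun _ _ => mul_nonneg hα.le (abs_nonneg _)) ω
  -- Off `A` the loss is at most `l (-δ)`, a gain of `l 0 - l (-δ)`. Half of that gain pays for
  -- `P(A) ≤ 1/2`, the other half for the tail loss `s`.
  calc ∫ ω, l (min (A.indicator (fun ω => α * |X ω|) ω) n - δ) ∂P
      ≤ ∫ ω, (l (-δ) + A.indicator (fun ω => (l 0 - l (-δ)) + young l (α * |X ω|)) ω) ∂P := by
        refine integral_mono (Integrable.of_mem_Icc (l (-δ)) (l (n - δ))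
          (hl.mono.measurable.comp ((((hX.abs.const_mul α).indicator hA).min
            measurable_const).sub_const δ)).aemeasurable (ae_of_all _ fun ω =>
          ⟨hl.mono ?_, hl.mono ?_⟩)) ((integrable_const _).add hind) fun ω => ?_
        · linarith [le_min (hT0 ω) (n.cast_nonneg (α := ℝ))]
        · linarith [min_le_right (A.indicator (fun ω => α * |X ω|) ω) (n : ℝ)]
        · have h1 := min_le_left (A.indicator (fun ω => α * |X ω|) ω) (n : ℝ)
          by_cases h : ω ∈ A
          · simp only [Set.indicator_of_mem h] at h1 ⊢
            rw [hy]
            have := hl.mono (show min (α * |X ω|) n - δ ≤ α * |X ω| by linarith)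
            linarith
          · simp only [Set.indicator_of_notMem h] at h1 ⊢
            have := hl.mono (show min 0 (n : ℝ) - δ ≤ -δ by linarith)
            linarith
    _ = l (-δ) + (P.real A * (l 0 - l (-δ)) + ∫ ω in A, young l (α * |X ω|) ∂P) := by
        rw [integral_add (integrable_const _) hind, integral_indicator hA,
          integral_add (integrable_const _) hyi, setIntegral_const, smul_eq_mul]
        simp
    _ ≤ l 0 := by nlinarith

/-- The threshold `s` depends only on `l`, `α` and `δ`, so one `N` makes capital `δ` sufficient in
every model at once. -/
theorem robustHeartU_subset_heartU [IsFiniteMeasure ℙ] (hl : IsLoss l) (h𝒬 : IsModelSet ℙ 𝒬) :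
    robustHeartU ℙ l 𝒬 ⊆ heartU ℙ (shortfall ℙ l 𝒬) := by
  intro X hX α hα
  rw [tendsto_order]
  refine ⟨fun a ha => Eventually.of_forall fun N =>
    ha.trans_le (hatExt_nonneg hl h𝒬 (tail_nonneg X N hα.le)), fun a ha => ?_⟩
  obtain ⟨δ, hδ, hδa⟩ := EReal.lt_iff_exists_real_btwn.mp ha
  have hδ0 : 0 < δ := by exact_mod_cast hδ
  set s := min ((l 0 - l (-δ)) / 2) ((l α - l 0) / 2)
  have hs : 0 < s := lt_min (half_pos (sub_pos.mpr (hl.lt_of_neg (by linarith))))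
    (half_pos (sub_pos.mpr (hl.lt_of_pos hα)))
  filter_upwards [ENNReal.tendsto_nhds_zero.mp (hX α hα) (ENNReal.ofReal s)
    (ENNReal.ofReal_pos.mpr hs), eventually_ge_atTop 1] with N hN hN1
  refine lt_of_le_of_lt (hatExt_le hl h𝒬 (aemeasurable_tail X N α) (tail_nonneg X N hα.le)
    hδ0.le fun n P hP => ?_) hδa
  have := h𝒬.prob P hP
  exact integral_min_tail_le hl X.measurable hα hN1 hs.le (min_le_left _ _) (min_le_right _ _)
    hδ0 ((le_iSup₂ (f := fun P (_ : P ∈ 𝒬) => ∫⁻ ω in {ω | (N : ℝ) < |X ω|},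
      ENNReal.ofReal (young l (α * |X ω|)) ∂P) P hP).trans hN) n

end

end RobustShortfall

theorem mainTheorem9 {Ω : Type*} [MeasurableSpace Ω] (ℙ : Measure Ω) [IsProbabilityMeasure ℙ]
    (l : ℝ → ℝ) (hl_mono : Monotone l) (hl_convex : ConvexOn ℝ Set.univ l)
    (hl_inf : ∃ x, l x < l 0)
    (𝒬 : Set (Measure Ω)) (h𝒬_nonempty : 𝒬.Nonempty)
    (h𝒬_prob : ∀ P ∈ 𝒬, IsProbabilityMeasure P ∧ P ≪ ℙ)
    (h𝒬 : RobustShortfall.IsConvexWeaklyCompact ℙ 𝒬) :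
    RobustShortfall.IsConvexRiskFunction ℙ (RobustShortfall.shortfall ℙ l 𝒬) ∧
    RobustShortfall.IsLebesgue ℙ (RobustShortfall.shortfall ℙ l 𝒬) ∧
    RobustShortfall.robustHeartU ℙ l 𝒬 =
      RobustShortfall.heartU ℙ (RobustShortfall.shortfall ℙ l 𝒬) ∧
    RobustShortfall.heartU ℙ (RobustShortfall.shortfall ℙ l 𝒬) ⊆
      RobustShortfall.heart ℙ (RobustShortfall.shortfall ℙ l 𝒬) ∧
    RobustShortfall.heart ℙ (RobustShortfall.shortfall ℙ l 𝒬) ⊆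
      RobustShortfall.robustHeart ℙ l 𝒬 := by
  have hl : RobustShortfall.IsLoss l := ⟨hl_mono, hl_convex, hl_inf⟩
  have hQ : RobustShortfall.IsModelSet ℙ 𝒬 :=
    ⟨h𝒬_nonempty, fun P hP => (h𝒬_prob P hP).1, fun P hP => (h𝒬_prob P hP).2⟩
  exact ⟨RobustShortfall.isConvexRiskFunction_shortfall hl hQ,
    RobustShortfall.isLebesgue_shortfall hl hQ h𝒬.2,
    (RobustShortfall.robustHeartU_subset_heartU hl hQ).antisymm
      (RobustShortfall.heartU_subset_robustHeartU hl hQ),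
    RobustShortfall.heartU_subset_heart hl hQ,
    RobustShortfall.heart_subset_robustHeart hl hQ⟩
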